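/- Compact spaces are assumed Hausdorff. A pseudocompact space is a Tychonoff (completely regular and $T_1$) space on which every continuous real-valued function is bounded. A space has countable Suslin number if every family of pairwise disjoint nonempty open subsets is at most countable. A compact space $Y$ is a Valdivia compact if it is homeomorphic to a compact $Z\subseteq\mathbb R^T$, for some set $T$, such that $\{z\in Z: |\{t\in T: z(t)\neq 0\}|\le\aleph_0\}$ is dense in $Z$. A sequence $(A_n)_{n=1}^\infty$ of nonempty subsets of a space converges to a point $a$ if every neighborhood of $a$ contains $A_n$ for all sufficiently large $n$. A function on $X\times Y$ is separately continuous if it is continuous in each variable when the other is fixed, and $D(f)$ denotes the set of points at which $f$ is discontinuous. **Theorem 4.2.** Assume that either (a) $X$ is a separable pseudocompact space and $Y$ is a compact space, or (b) $X$ is a pseudocompact space with countable Suslin number and $Y$ is a Valdivia compact. Let $x_0\in X$ and $y_0\in Y$ be non-isolated points. Then the following conditions are equivalent: (i) there exist sequences $(U_n)_{n=1}^\infty$ and $(V_n)_{n=1}^\infty$ of nonempty open sets $U_n\subseteq X$ and $V_n\subseteq Y$ which converge to $x_0$ in $X$ and to $y_0$ in $Y$, respectively; (ii) there exists a separately continuous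 function $f:X\times Y\to\mathbb R$ with $D(f)=\{(x_0,y_0)\}$. -/

import Mathlib

open Set Topology

/-- A completely regular (`T₁` included, i.e. Tychonoff) space is pseudocompact if every
continuous real-valued function on it is bounded. -/
structure IsPseudocompactSpace (X : Type*) [TopologicalSpace X] : Prop where
  t35 : T35Space X
  bounded : ∀ f : X → ℝ, Continuous f → ∃ M : ℝ, ∀ x, |f x| ≤ M

/-- Countable Suslin number: every family of pairwise disjoint nonempty open sets is countable. -/
def HasCountableSuslinNumber (X : Type*) [TopologicalSpace X] : Prop :=
  ∀ 𝒰 : Set (Set X), (∀ U ∈ 𝒰, IsOpen U ∧ U.Nonempty) → 𝒰.PairwiseDisjoint id → 𝒰.Countable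

/-- Valdivia compacta: spaces homeomorphic to a compact `Z ⊆ ℝ^T` in which the points of countable
support are dense. Taking `T` in the universe of `Y` is no restriction: coordinates that agree on
`Z` may be identified, and the distinct ones inject into `Y → ℝ`. -/
def IsValdiviaCompact.{u} (Y : Type u) [TopologicalSpace Y] : Prop :=
  ∃ (T : Type u) (Z : Set (T → ℝ)), IsCompact Z ∧ Nonempty (Y ≃ₜ Z) ∧
    Dense {z : Z | (Function.support (z : T → ℝ)).Countable}

/-- A sequence of nonempty sets converges to `x₀` if every neighbourhood of `x₀` contains all but
finitely many of its members. -/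
def SetsConvergeTo {X : Type*} [TopologicalSpace X] (A : ℕ → Set X) (x₀ : X) : Prop :=
  (∀ n, (A n).Nonempty) ∧ ∀ U ∈ 𝓝 x₀, ∃ n₀, ∀ n ≥ n₀, A n ⊆ U

/-- Continuity in each variable separately. -/
def SeparatelyContinuous {X Y : Type*} [TopologicalSpace X] [TopologicalSpace Y]
    (f : X × Y → ℝ) : Prop :=
  (∀ x, Continuous fun y => f (x, y)) ∧ ∀ y, Continuous fun x => f (x, y)

/-- The set `D(f)` of points of discontinuity of `f`. -/
def discontinuitySet {X Y : Type*} [TopologicalSpace X] [TopologicalSpace Y] (f : X → Y) : Set X :=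
  {x | ¬ ContinuousAt f x}

/-! From convergent open sets, sum products of bumps living on `U n ×ˢ V n`. The sum is locally
finite off `(x₀, y₀)` and vanishes on both lines through that point, yet is at least 1 at points
arbitrarily near it.

Conversely, subtract a continuous function so that `f` vanishes on both lines. Suppose countably
many sections of `f` decide where it vanishes. Near the point choose open boxes on which `|f| > ε /
2` while the first `n` sections are below `1 / (n + 1)`. At a cluster point of the boxes all
sections vanish, hence so does `f`, which is then discontinuous there: only `(x₀, y₀)` qualifies.
Since `X × Y` is feebly compact, a unique cluster point forces convergence.

For separable `X` a countable dense set supplies the sections. For Valdivia `Y`, the Suslin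
condition makes `f (x, ·)` on countably supported points depend on countably many coordinates, the
same for all `x`. -/

open Filter

/-- Every sequence of nonempty open sets has a cluster point. -/
def IsFeeblyCompact (X : Type*) [TopologicalSpace X] : Prop :=
  ∀ U : ℕ → Set X, (∀ n, IsOpen (U n)) → (∀ n, (U n).Nonempty) →
    ∃ x, ∀ m, x ∈ closure (⋃ n ≥ m, U n)

/-! ### Feeble compactness and convergence of open sets -/

theorem exists_bump {X : Type*} [TopologicalSpace X] [CompletelyRegularSpace X] {x : X} {U : Set X}
    (hU : U ∈ 𝓝 x) :
    ∃ φ : X → ℝ, Continuous φ ∧ (∀ z, 0 ≤ φ z) ∧ φ x = 1 ∧ ∀ z ∉ U, φ z = 0 := by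
  obtain ⟨f, hf, hfx, hfU⟩ := CompletelyRegularSpace.completely_regular x (interior U)ᶜ
    isOpen_interior.isClosed_compl (by simpa using mem_interior_iff_mem_nhds.2 hU)
  refine ⟨fun z => 1 - (f z : ℝ), by fun_prop, fun z => by linarith [(f z).2.2], by simp [hfx],
    fun z hz => ?_⟩
  have : f z = 1 := hfU fun h => hz (interior_subset h)
  simp [this]

/-- Without a cluster point the family is locally finite, and bumps weighted by `n` add up to an
unbounded continuous function. -/
theorem IsPseudocompactSpace.isFeeblyCompact {X : Type*} [TopologicalSpace X]
    (hX : IsPseudocompactSpace X) : IsFeeblyCompact X := by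
  intro U hUo hUne
  by_contra! hcon
  have := hX.t35
  choose p hp using hUne
  choose φ hφ hφ0 hφ1 hφU using fun n => exists_bump ((hUo n).mem_nhds (hp n))
  have hlf : LocallyFinite U := by
    intro x
    obtain ⟨m, hm⟩ := hcon x
    refine ⟨_, isClosed_closure.isOpen_compl.mem_nhds hm, (finite_lt_nat m).subset ?_⟩
    rintro n ⟨z, hz, hz'⟩
    by_contra hn
    exact hz' (subset_closure (mem_biUnion (show n ≥ m from not_lt.1 hn) hz))
  have hlf' : LocallyFinite fun n => Function.support fun x => ((n : ℕ) : ℝ) * φ n x :=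
    hlf.subset fun n x hx => by
      by_contra h
      rw [Function.mem_support] at hx
      exact hx (by simp [hφU n x h])
  obtain ⟨M, hM⟩ := hX.bounded _ (continuous_finsum (fun n => continuous_const.mul (hφ n)) hlf')
  obtain ⟨n, hn⟩ := exists_nat_gt M
  have h1 := (le_abs_self _).trans (hM (p n))
  have h2 : (n : ℝ) * φ n (p n) ≤ ∑ᶠ i : ℕ, (i : ℝ) * φ i (p n) :=
    single_le_finsum n (hlf'.point_finite (p n)) fun i => mul_nonneg i.cast_nonneg (hφ0 i _)
  rw [hφ1, mul_one] at h2
  exact (hn.trans_le (h2.trans h1)).false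

theorem IsFeeblyCompact.prod {X Y : Type*} [TopologicalSpace X] [TopologicalSpace Y]
    [CompactSpace Y] (hX : IsFeeblyCompact X) : IsFeeblyCompact (X × Y) := by
  intro W hWo hWne
  obtain ⟨x, hx⟩ := hX (fun n => Prod.fst '' W n) (fun n => isOpenMap_fst _ (hWo n))
    fun n => (hWne n).image _
  let F : ℕ → Set Y := fun m => (fun y => (x, y)) ⁻¹' closure (⋃ n ≥ m, W n)
  have hFc : ∀ m, IsClosed (F m) := fun m => isClosed_closure.preimage (by fun_prop)
  obtain ⟨y, hy⟩ := IsCompact.nonempty_iInter_of_sequence_nonempty_isCompact_isClosed F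
    (fun m => preimage_mono (closure_mono
      (biUnion_subset_biUnion_left fun n (hn : n ≥ m + 1) => (Nat.le_succ m).trans hn)))
    (fun m => by
      have h := hx m
      rw [← image_iUnion₂] at h
      obtain ⟨⟨a, y⟩, hp, rfl⟩ :=
        isClosedMap_fst_of_compactSpace.closure_image_subset _ h
      exact ⟨y, hp⟩)
    (hFc 0).isCompact hFc
  exact ⟨(x, y), fun m => mem_iInter.1 hy m⟩

/-- If infinitely many members left a neighbourhood of `p`, their parts off a smaller closed
neighbourhood `C` would cluster, necessarily at `p`, which `C` prevents. -/
theorem IsFeeblyCompact.setsConvergeTo {P : Type*} [TopologicalSpace P] [RegularSpace P]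
    (hP : IsFeeblyCompact P) {W : ℕ → Set P} (hWo : ∀ n, IsOpen (W n))
    (hWne : ∀ n, (W n).Nonempty) {p : P}
    (huniq : ∀ q, (∀ m, q ∈ closure (⋃ n ≥ m, W n)) → q = p) : SetsConvergeTo W p := by
  refine ⟨hWne, fun O hO => ?_⟩
  obtain ⟨C, hC, hCc, hCO⟩ := exists_mem_nhds_isClosed_subset hO
  by_contra! hcon
  obtain ⟨k, hk, hkW⟩ := extraction_of_frequently_atTop
    (frequently_atTop.2 fun m => (hcon m : ∃ n ≥ m, ¬ W n ⊆ O))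
  obtain ⟨q, hq⟩ := hP (fun i => W (k i) \ C) (fun i => (hWo _).sdiff hCc) fun i => by
    obtain ⟨z, hz, hz'⟩ := not_subset.1 (hkW i)
    exact ⟨z, hz, fun h => hz' (hCO h)⟩
  obtain rfl := huniq q fun m => closure_mono
    (iUnion₂_subset fun i (hi : i ≥ m) =>
      sdiff_subset.trans (subset_biUnion_of_mem (u := W) (hi.trans (hk.id_le i)))) (hq m)
  obtain ⟨z, hz, hz'⟩ := mem_closure_iff_nhds.1 (hq 0) C hC
  simp only [mem_iUnion] at hz'
  obtain ⟨i, -, hi⟩ := hz'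
  exact hi.2 hz

theorem setsConvergeTo_of_prod {X Y : Type*} [TopologicalSpace X] [TopologicalSpace Y]
    {U : ℕ → Set X} {V : ℕ → Set Y} {x : X} {y : Y}
    (h : SetsConvergeTo (fun n => U n ×ˢ V n) (x, y)) :
    SetsConvergeTo U x ∧ SetsConvergeTo V y := by
  refine ⟨⟨fun n => (h.1 n).fst, fun O hO => ?_⟩, ⟨fun n => (h.1 n).snd, fun O hO => ?_⟩⟩
  · obtain ⟨m, hm⟩ := h.2 _ (prod_mem_nhds hO univ_mem)
    refine ⟨m, fun n hn a ha => ?_⟩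
    obtain ⟨b, hb⟩ := (h.1 n).snd
    exact (hm n hn (mk_mem_prod ha hb)).1
  · obtain ⟨m, hm⟩ := h.2 _ (prod_mem_nhds univ_mem hO)
    refine ⟨m, fun n hn b hb => ?_⟩
    obtain ⟨a, ha⟩ := (h.1 n).fst
    exact (hm n hn (mk_mem_prod ha hb)).2

/-! ### From an isolated discontinuity to convergent boxes -/

theorem exists_setsConvergeTo_of_discontinuitySet_eq_singleton {X Y : Type*} [TopologicalSpace X]
    [TopologicalSpace Y] [RegularSpace X] [RegularSpace Y] [CompactSpace Y]
    (hX : IsFeeblyCompact X) {f : X × Y → ℝ} {x₀ : X} {y₀ : Y}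
    (hD : discontinuitySet f = {(x₀, y₀)}) (hf0 : f (x₀, y₀) = 0) {g : ℕ → X × Y → ℝ}
    (hg : ∀ i, Continuous (g i)) (hg0 : ∀ i, g i (x₀, y₀) = 0)
    (hgf : ∀ p, (∀ i, g i p = 0) → f p = 0) :
    (∃ U : ℕ → Set X, (∀ n, IsOpen (U n)) ∧ SetsConvergeTo U x₀) ∧
      (∃ V : ℕ → Set Y, (∀ n, IsOpen (V n)) ∧ SetsConvergeTo V y₀) := by
  have hcont : ∀ p, p ≠ (x₀, y₀) → ContinuousAt f p := fun p hp => by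
    by_contra h
    exact hp (hD.subset h)
  have hdisc : ¬ ContinuousAt f (x₀, y₀) := hD.superset rfl
  obtain ⟨ε, hε, hdisc⟩ : ∃ ε > 0, ∃ᶠ p in 𝓝 (x₀, y₀), ε ≤ |f p| := by
    by_contra! h
    refine hdisc (Metric.tendsto_nhds.2 fun ε hε => ?_)
    simpa [hf0, Filter.not_frequently] using h ε hε
  have hbox : ∀ n : ℕ, ∃ (U : Set X) (V : Set Y), IsOpen U ∧ IsOpen V ∧ (U ×ˢ V).Nonempty ∧
      ∀ p ∈ U ×ˢ V, ε / 2 < |f p| ∧ ∀ i ≤ n, |g i p| < 1 / (n + 1 : ℝ) := by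
    intro n
    have hn : (0 : ℝ) < 1 / (n + 1 : ℝ) := by positivity
    have hO : IsOpen {p | ∀ i ≤ n, |g i p| < 1 / (n + 1 : ℝ)} := by
      have : {p | ∀ i ≤ n, |g i p| < 1 / (n + 1 : ℝ)} =
          ⋂ i ∈ Iic n, {p | |g i p| < 1 / (n + 1 : ℝ)} := by ext; simp
      rw [this]
      exact (finite_Iic n).isOpen_biInter fun i _ =>
        isOpen_lt (hg i).abs continuous_const
    obtain ⟨p, hp, hpO⟩ := (hdisc.and_eventually (hO.mem_nhds fun i _ => by
      rw [hg0, abs_zero]; exact hn)).exists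
    have hp0 : p ≠ (x₀, y₀) := by
      rintro rfl
      rw [hf0, abs_zero] at hp
      linarith
    have hev : ∀ᶠ q in 𝓝 p, ε / 2 < |f q| :=
      ((hcont p hp0).abs).eventually_const_lt (show ε / 2 < |f p| by linarith)
    obtain ⟨a, b⟩ := p
    obtain ⟨U, V, hUo, haU, hVo, hbV, hUV⟩ :=
      mem_nhds_prod_iff'.1 (hev.and (hO.mem_nhds hpO))
    exact ⟨U, V, hUo, hVo, ⟨(a, b), haU, hbV⟩, fun q hq => hUV hq⟩
  choose U V hUo hVo hne hUV using hbox
  have hconv : SetsConvergeTo (fun n => U n ×ˢ V n) (x₀, y₀) := by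
    refine hX.prod.setsConvergeTo (fun n => (hUo n).prod (hVo n)) hne fun q hq => ?_
    by_contra hq0
    have hfq : f q = 0 := hgf q fun i => by
      refine abs_nonpos_iff.1 (le_of_forall_pos_le_add fun δ hδ => ?_)
      obtain ⟨m, hm⟩ := exists_nat_one_div_lt hδ
      rw [zero_add]
      have hcl : IsClosed {p | |g i p| ≤ δ} := isClosed_le (hg i).abs continuous_const
      -- The tail from `max m i` ensures both that section `i` is controlled and that the bound is
      -- below `δ`.
      refine closure_minimal (iUnion₂_subset fun n (hn : n ≥ max m i) p hp => ?_) hcl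
        (hq (max m i))
      have h1 := (hUV n p hp).2 i ((le_max_right _ _).trans hn)
      have h2 : 1 / (n + 1 : ℝ) ≤ 1 / (m + 1 : ℝ) :=
        one_div_le_one_div_of_le (by positivity)
          (by have := (le_max_left m i).trans hn; gcongr)
      exact (h1.trans_le (h2.trans hm.le)).le
    have hev : ∀ᶠ p in 𝓝 q, |f p| < ε / 2 :=
      ((hcont q hq0).abs).eventually_lt_const (show |f q| < ε / 2 by rw [hfq, abs_zero]; positivity)
    obtain ⟨p, hp, hp'⟩ := mem_closure_iff_nhds.1 (hq 0) _ hev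
    simp only [mem_iUnion] at hp'
    obtain ⟨n, -, hn⟩ := hp'
    exact lt_asymm hp (hUV n p hn).1
  have h := setsConvergeTo_of_prod hconv
  exact ⟨⟨U, hUo, h.1⟩, ⟨V, hVo, h.2⟩⟩

/-! ### From convergent open sets to a function -/

theorem SetsConvergeTo.locallyFinite_nhds {X : Type*} [TopologicalSpace X] [T2Space X]
    {U : ℕ → Set X} {x₀ x : X} (hU : SetsConvergeTo U x₀) (hx : x ≠ x₀) :
    ∃ t ∈ 𝓝 x, {n | (U n ∩ t).Nonempty}.Finite := by
  obtain ⟨A, B, hA, hB, hxA, hxB, hAB⟩ := t2_separation hx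
  obtain ⟨m, hm⟩ := hU.2 B (hB.mem_nhds hxB)
  refine ⟨A, hA.mem_nhds hxA, (finite_lt_nat m).subset ?_⟩
  rintro n ⟨z, hz, hz'⟩
  by_contra hn
  exact disjoint_left.1 hAB hz' (hm n (not_lt.1 hn) hz)

/-- As `x₀` is not isolated, it can be removed from each `U n`; bumps vanishing at `x₀` keep the
later sum zero on the lines through the point. -/
theorem SetsConvergeTo.exists_bumps {X : Type*} [TopologicalSpace X] [T35Space X]
    {U : ℕ → Set X} {x₀ : X} (hU : SetsConvergeTo U x₀) (hUo : ∀ n, IsOpen (U n))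
    (hx₀ : ¬ IsOpen ({x₀} : Set X)) :
    ∃ (p : ℕ → X) (φ : ℕ → X → ℝ), (∀ n, p n ∈ U n) ∧ (∀ n, Continuous (φ n)) ∧
      (∀ n z, 0 ≤ φ n z) ∧ (∀ n, φ n (p n) = 1) ∧ (∀ n, φ n x₀ = 0) ∧
      ∀ n, ∀ z ∉ U n, φ n z = 0 := by
  have hne : ∀ n, (U n \ {x₀}).Nonempty := by
    intro n
    by_contra! h
    rw [sdiff_eq_empty] at h
    obtain h | h := subset_singleton_iff_eq.1 h
    · exact (hU.1 n).ne_empty h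
    · exact hx₀ (h ▸ hUo n)
  choose p hp using hne
  choose φ hφ hφ0 hφ1 hφU using fun n =>
    exists_bump (((hUo n).sdiff isClosed_singleton).mem_nhds (hp n))
  exact ⟨p, φ, fun n => (hp n).1, hφ, hφ0, hφ1, fun n => hφU n _ fun h => h.2 rfl,
    fun n z hz => hφU n z fun h => hz h.1⟩

theorem exists_separatelyContinuous_of_setsConvergeTo {X Y : Type*} [TopologicalSpace X]
    [TopologicalSpace Y] [T35Space X] [T35Space Y] {x₀ : X} {y₀ : Y}
    (hx₀ : ¬ IsOpen ({x₀} : Set X)) (hy₀ : ¬ IsOpen ({y₀} : Set Y))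
    {U : ℕ → Set X} (hUo : ∀ n, IsOpen (U n)) (hU : SetsConvergeTo U x₀)
    {V : ℕ → Set Y} (hVo : ∀ n, IsOpen (V n)) (hV : SetsConvergeTo V y₀) :
    ∃ f : X × Y → ℝ, SeparatelyContinuous f ∧ discontinuitySet f = {(x₀, y₀)} := by
  obtain ⟨p, φ, hp, hφ, hφ0, hφ1, hφx, hφU⟩ := hU.exists_bumps hUo hx₀
  obtain ⟨q, ψ, hq, hψ, hψ0, hψ1, hψy, hψV⟩ := hV.exists_bumps hVo hy₀
  let F : ℕ → X × Y → ℝ := fun n z => φ n z.1 * ψ n z.2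
  have hF : ∀ n, Continuous (F n) := fun n => by fun_prop
  have hF0 : ∀ n z, 0 ≤ F n z := fun n z => mul_nonneg (hφ0 n _) (hψ0 n _)
  have hsupp : ∀ n z, z ∈ Function.support (F n) → z.1 ∈ U n ∧ z.2 ∈ V n := by
    refine fun n z hz => ⟨?_, ?_⟩ <;> by_contra h
    · exact hz (by simp [F, hφU n _ h])
    · exact hz (by simp [F, hψV n _ h])
  have hlf : ∀ z ≠ (x₀, y₀), ∃ t ∈ 𝓝 z, {n | (Function.support (F n) ∩ t).Nonempty}.Finite := by
    rintro ⟨x, y⟩ hz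
    by_cases hx : x = x₀
    · have hy : y ≠ y₀ := by rintro rfl; exact hz (by rw [hx])
      obtain ⟨t, ht, hfin⟩ := hV.locallyFinite_nhds hy
      refine ⟨Prod.snd ⁻¹' t, continuousAt_snd ht, hfin.subset ?_⟩
      rintro n ⟨w, hw, hwt⟩
      exact ⟨w.2, (hsupp n w hw).2, hwt⟩
    · obtain ⟨t, ht, hfin⟩ := hU.locallyFinite_nhds hx
      refine ⟨Prod.fst ⁻¹' t, continuousAt_fst ht, hfin.subset ?_⟩
      rintro n ⟨w, hw, hwt⟩
      exact ⟨w.1, (hsupp n w hw).1, hwt⟩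
  let f : X × Y → ℝ := fun z => ∑ᶠ n, F n z
  have hx : ∀ y, f (x₀, y) = 0 := fun y => by simp [f, F, hφx]
  have hy : ∀ x, f (x, y₀) = 0 := fun x => by simp [f, F, hψy]
  have hfc : ∀ z ≠ (x₀, y₀), ContinuousAt f z := by
    intro z hz
    obtain ⟨t, ht, hfin⟩ := hlf z hz
    have heq : f =ᶠ[𝓝 z] fun w => ∑ n ∈ hfin.toFinset, F n w := by
      filter_upwards [ht] with w hw
      refine finsum_eq_sum_of_support_subset _ fun n hn => ?_
      simpa using ⟨w, hn, hw⟩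
    exact ContinuousAt.congr (by fun_prop) heq.symm
  refine ⟨f, ⟨fun x => ?_, fun y => ?_⟩, Subset.antisymm (fun z hz => ?_) ?_⟩
  · by_cases h : x = x₀
    · subst h; simpa only [hx] using continuous_const
    · refine continuous_iff_continuousAt.2 fun y => ?_
      exact (hfc (x, y) fun e => h (congrArg Prod.fst e)).comp (f := fun y => (x, y))
        (by fun_prop : ContinuousAt (fun y => (x, y)) y)
  · by_cases h : y = y₀
    · subst h; simpa only [hy] using continuous_const
    · refine continuous_iff_continuousAt.2 fun x => ?_
      exact (hfc (x, y) fun e => h (congrArg Prod.snd e)).comp (f := fun x => (x, y))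
        (by fun_prop : ContinuousAt (fun x => (x, y)) x)
  · by_contra h
    exact hz (hfc z h)
  · rintro _ rfl hcont
    have hev : ∀ᶠ z in 𝓝 (x₀, y₀), f z < 1 :=
      hcont.eventually_lt_const (by rw [hx]; exact one_pos)
    obtain ⟨A, hA, B, hB, hAB⟩ := mem_nhds_prod_iff.1 hev
    obtain ⟨m, hm⟩ := hU.2 A hA
    obtain ⟨k, hk⟩ := hV.2 B hB
    set n := max m k
    have h1 : f (p n, q n) < 1 := hAB
      ⟨hm n (le_max_left _ _) (hp n), hk n (le_max_right _ _) (hq n)⟩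
    have hne : (p n, q n) ≠ (x₀, y₀) := fun e => by
      have h := hφ1 n
      rw [show p n = x₀ from congrArg Prod.fst e, hφx] at h
      exact zero_ne_one h
    obtain ⟨t, ht, hfin⟩ := hlf _ hne
    have h2 : F n (p n, q n) ≤ f (p n, q n) :=
      single_le_finsum n (f := fun i => F i (p n, q n))
        (hfin.subset fun i hi => ⟨_, hi, mem_of_mem_nhds ht⟩) fun i => hF0 i _
    simp only [F, hφ1, hψ1] at h2
    linarith
-- Countable Suslin number and countable supports
-- A maximal disjoint family of open sets refining `𝒢` is countable; keep one member of `𝒢` around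
-- each.
theorem HasCountableSuslinNumber.exists_countable_subset_closure {X : Type*} [TopologicalSpace X]
    (hX : HasCountableSuslinNumber X) {𝒢 : Set (Set X)} (h𝒢 : ∀ G ∈ 𝒢, IsOpen G) :
    ∃ 𝒞 ⊆ 𝒢, 𝒞.Countable ∧ ∀ G ∈ 𝒢, G ⊆ closure (⋃₀ 𝒞) := by
  obtain ⟨𝒰, h𝒰⟩ := zorn_subset
    {𝒰 : Set (Set X) | (∀ U ∈ 𝒰, IsOpen U ∧ U.Nonempty ∧ ∃ G ∈ 𝒢, U ⊆ G) ∧ 𝒰.PairwiseDisjoint id}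
    fun c hc hchain => ⟨⋃₀ c,
      ⟨fun U ⟨𝒱, h𝒱, hU⟩ => (hc h𝒱).1 U hU,
        (pairwiseDisjoint_sUnion hchain.directedOn).2 fun 𝒱 h𝒱 => (hc h𝒱).2⟩,
      fun 𝒱 h𝒱 => subset_sUnion_of_mem h𝒱⟩
  obtain ⟨h1, h2⟩ := h𝒰.prop
  have hcount : 𝒰.Countable := hX 𝒰 (fun U hU => ⟨(h1 U hU).1, (h1 U hU).2.1⟩) h2
  choose! Φ hΦ hUΦ using fun U hU => (h1 U hU).2.2
  refine ⟨Φ '' 𝒰, image_subset_iff.2 hΦ, hcount.image Φ, fun G hG => ?_⟩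
  by_contra hne
  set U := G \ closure (⋃₀ (Φ '' 𝒰)) with hU
  have hUne : U.Nonempty := by
    obtain ⟨z, hz, hz'⟩ := not_subset.1 hne
    exact ⟨z, hz, hz'⟩
  have hdisj : ∀ V ∈ 𝒰, Disjoint U V := fun V hV => disjoint_left.2 fun z hz hzV =>
    hz.2 (subset_closure ⟨_, mem_image_of_mem Φ hV, hUΦ V hV hzV⟩)
  have hmem : U ∈ 𝒰 := h𝒰.le_of_ge (y := insert U 𝒰)
    ⟨by
      rintro V (rfl | hV)
      · exact ⟨(h𝒢 G hG).sdiff isClosed_closure, hUne, G, hG, sdiff_subset⟩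
      · exact h1 V hV,
      h2.insert fun V hV _ => hdisj V hV⟩ (subset_insert U 𝒰) (mem_insert U 𝒰)
  exact hUne.ne_empty (disjoint_self.1 (hdisj U hmem))

section CountableSupport

variable {Y T : Type*} [TopologicalSpace Y] {e : Y → T → ℝ}

theorem exists_countable_restrict_mem_closure (he : Continuous e)
    (hd : Dense {y | (Function.support (e y)).Countable}) {A : Set T} (hA : A.Countable) :
    ∃ C : Set Y, C.Countable ∧ (∀ c ∈ C, (Function.support (e c)).Countable) ∧
      ∀ y, A.domRestrict (e y) ∈ closure ((fun y => A.domRestrict (e y)) '' C) := by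
  have := hA.to_subtype
  let ρ : Y → A → ℝ := fun y => A.domRestrict (e y)
  have hρ : Continuous ρ := by
    refine continuous_pi fun t => ?_
    exact (continuous_apply (t : T)).comp he
  obtain ⟨c, hc, hcd⟩ := TopologicalSpace.exists_countable_dense
    (ρ '' {y | (Function.support (e y)).Countable})
  choose g hg hgρ using fun s : ρ '' {y | (Function.support (e y)).Countable} => s.2
  refine ⟨g '' c, hc.image g, ?_, fun y => ?_⟩
  · rintro _ ⟨s, -, rfl⟩
    exact hg s
  · have h1 : ρ y ∈ closure (ρ '' {y | (Function.support (e y)).Countable}) :=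
      image_closure_subset_closure_image hρ ⟨y, hd y, rfl⟩
    have h2 : ρ '' (g '' c) = Subtype.val '' c := by
      rw [image_image]
      exact image_congr fun s _ => hgρ s
    change ρ y ∈ closure (ρ '' (g '' c))
    rw [h2]
    exact closure_minimal (Subtype.dense_iff.1 hcd) isClosed_closure h1

/-- A countable set of coordinates can be enlarged to a countable set `A` such that cutting off
the coordinates outside `A` preserves the image of `e`; moreover the cut-offs are approximated by
countably many points supported in `A`. -/
theorem exists_countable_indicator_mem_closure (he : Continuous e)
    (hd : Dense {y | (Function.support (e y)).Countable}) {B : Set T} (hB : B.Countable) :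
    ∃ A : Set T, B ⊆ A ∧ A.Countable ∧ ∃ C : Set Y, C.Countable ∧
      ∀ y, A.indicator (e y) ∈ closure (e '' C) := by
  choose! C hC hCs hCd using fun (A : Set T) (hA : A.Countable) =>
    exists_countable_restrict_mem_closure he hd hA
  -- Each stage adds the supports of its approximating points, so in the limit these points vanish
  -- outside the union, as the cut-offs do.
  obtain ⟨A, hA0, hAs⟩ : ∃ A : ℕ → Set T, A 0 = B ∧
      ∀ n, A (n + 1) = A n ∪ ⋃ c ∈ C (A n), Function.support (e c) :=
    ⟨fun n => Nat.rec B (fun _ A => A ∪ ⋃ c ∈ C A, Function.support (e c)) n, rfl, fun _ => rfl⟩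
  have hA : ∀ n, (A n).Countable := by
    intro n
    induction n with
    | zero => exact hA0 ▸ hB
    | succ n ih => exact hAs n ▸ ih.union ((hC _ ih).biUnion (hCs _ ih))
  have hmono : Monotone A := monotone_nat_of_le_succ fun n => hAs n ▸ subset_union_left
  refine ⟨⋃ n, A n, hA0 ▸ subset_iUnion A 0, countable_iUnion hA, ⋃ n, C (A n),
    countable_iUnion fun n => hC _ (hA n), fun y => mem_closure_iff.2 fun O hO hyO => ?_⟩
  obtain ⟨F, u, hu, hFO⟩ := isOpen_pi_iff.1 hO _ hyO
  obtain ⟨n, hn⟩ : ∃ n, ∀ t ∈ F, t ∈ ⋃ n, A n → t ∈ A n := by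
    have : ∀ t, ∃ n, t ∈ ⋃ n, A n → t ∈ A n := fun t => by
      by_cases h : t ∈ ⋃ n, A n
      · obtain ⟨n, hn⟩ := mem_iUnion.1 h
        exact ⟨n, fun _ => hn⟩
      · exact ⟨0, fun h' => absurd h' h⟩
    choose N hN using this
    exact ⟨F.sup N, fun t ht h => hmono (Finset.le_sup ht) (hN t h)⟩
  have hfin : ((fun t : A n => (t : T)) ⁻¹' F).Finite :=
    F.finite_toSet.preimage fun a _ b _ hab => Subtype.ext hab
  have hopen : IsOpen (pi ((fun t : A n => (t : T)) ⁻¹' F) fun t => u t) :=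
    isOpen_set_pi hfin fun t ht => (hu t ht).1
  obtain ⟨_, hv, c, hc, rfl⟩ := mem_closure_iff.1 (hCd _ (hA n) y) _ hopen fun t ht => by
    have := (hu t ht).2
    rwa [indicator_of_mem (mem_iUnion.2 ⟨n, t.2⟩)] at this
  refine ⟨e c, hFO fun t ht => ?_, c, mem_iUnion.2 ⟨n, hc⟩, rfl⟩
  by_cases htA : t ∈ ⋃ n, A n
  · exact hv ⟨t, hn t ht htA⟩ ht
  · have h0 : e c t = 0 := by
      by_contra h
      exact htA (mem_iUnion.2 ⟨n + 1, hAs n ▸ Or.inr (mem_biUnion hc h)⟩)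
    have := (hu t ht).2
    rw [indicator_of_notMem htA] at this
    rwa [h0]

variable {X : Type*} [TopologicalSpace X] [CompactSpace Y]

/-- Otherwise one builds shrinking open sets and pairs of points agreeing on ever more coordinates,
with `f` oscillating by more than `δ`. At a cluster point `p` in `X`, compactness of `Y` makes the
pairs cluster on the diagonal, against continuity of `f (p, ·)`. -/
theorem exists_countable_oscillation_le (hX : IsFeeblyCompact X) (hS : HasCountableSuslinNumber X)
    (he : IsEmbedding e) {f : X × Y → ℝ} (hf : SeparatelyContinuous f) {δ : ℝ} (hδ : 0 < δ) :
    ∃ A : Set T, A.Countable ∧ ∀ x z w, (Function.support (e z)).Countable →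
      (Function.support (e w)).Countable → EqOn (e z) (e w) A → |f (x, z) - f (x, w)| ≤ δ := by
  let G : Set T → Set X := fun A => {x | ∃ z w, (Function.support (e z)).Countable ∧
    (Function.support (e w)).Countable ∧ EqOn (e z) (e w) A ∧ δ < |f (x, z) - f (x, w)|}
  have hosc : ∀ z w, Continuous fun x => |f (x, z) - f (x, w)| := fun z w =>
    ((hf.2 z).sub (hf.2 w)).abs
  have hGo : ∀ A, IsOpen (G A) := fun A => by
    refine isOpen_iff_mem_nhds.2 ?_
    rintro x ⟨z, w, hz, hw, hzw, hx⟩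
    filter_upwards [(isOpen_lt continuous_const (hosc z w)).mem_nhds hx] with x' hx'
    exact ⟨z, w, hz, hw, hzw, hx'⟩
  obtain ⟨𝒞, h𝒞, hcount, hcl⟩ := hS.exists_countable_subset_closure
    (𝒢 := {U : Set X | IsOpen U ∧ ∃ A : Set T, A.Countable ∧ Disjoint U (G A)}) fun U hU => hU.1
  choose! Φ hΦ hΦG using fun (U : Set X) (hU : U ∈ 𝒞) => (h𝒞 hU).2
  set A₀ := ⋃ U ∈ 𝒞, Φ U with hA₀
  have hA₀c : A₀.Countable := hcount.biUnion hΦ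
  have hdisj : ∀ U ∈ 𝒞, Disjoint U (G A₀) := fun U hU =>
    (hΦG U hU).mono_right (by
      rintro x ⟨z, w, hz, hw, hzw, hx⟩
      exact ⟨z, w, hz, hw, hzw.mono (subset_biUnion_of_mem (u := Φ) hU), hx⟩)
  refine ⟨A₀, hA₀c, fun x z w hz hw hzw => ?_⟩
  by_contra! hx
  -- `G` is antitone, so `A₀` serves all of `𝒞` at once; an open subset of `G A₀` missing some `G A`
  -- would lie in the closure of `⋃₀ 𝒞`, which is disjoint from `G A₀`.
  have hmeet : ∀ U ⊆ G A₀, IsOpen U → U.Nonempty → ∀ A : Set T, A.Countable →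
      (U ∩ G A).Nonempty := by
    intro U hU hUo hUne A hA
    rw [← not_disjoint_iff_nonempty_inter]
    intro h
    obtain ⟨p, hp⟩ := hUne
    obtain ⟨q, hq, V, hV, hqV⟩ := mem_closure_iff.1 (hcl U ⟨hUo, A, hA, h⟩ hp) _ (hGo A₀) (hU hp)
    exact disjoint_left.1 (hdisj V hV) hqV hq
  let S := {s : Set X × Set T // IsOpen s.1 ∧ s.1.Nonempty ∧ s.1 ⊆ G A₀ ∧ s.2.Countable}
  have step : ∀ s : S, ∃ (s' : S) (z w : Y), EqOn (e z) (e w) s.1.2 ∧ s.1.2 ⊆ s'.1.2 ∧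
      Function.support (e z) ⊆ s'.1.2 ∧ Function.support (e w) ⊆ s'.1.2 ∧ s'.1.1 ⊆ s.1.1 ∧
      ∀ x ∈ s'.1.1, δ < |f (x, z) - f (x, w)| := by
    rintro ⟨⟨U, A⟩, hUo, hUne, hUG, hA⟩
    obtain ⟨p, hpU, z, w, hz, hw, hzw, hp⟩ := hmeet U hUG hUo hUne A hA
    refine ⟨⟨(U ∩ {x | δ < |f (x, z) - f (x, w)|},
      A ∪ (Function.support (e z) ∪ Function.support (e w))),
      hUo.inter (isOpen_lt continuous_const (hosc z w)), ⟨p, hpU, hp⟩,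
      inter_subset_left.trans hUG, hA.union (hz.union hw)⟩, z, w, hzw, subset_union_left,
      subset_union_left.trans subset_union_right, subset_union_right.trans subset_union_right,
      inter_subset_left, fun x hx => hx.2⟩
  choose next z' w' hzw' hsub hz' hw' hle hlt using step
  let s : ℕ → S := fun n =>
    Nat.rec ⟨(G A₀, ∅), hGo A₀, ⟨x, z, w, hz, hw, hzw, hx⟩, Subset.rfl, countable_empty⟩
      (fun _ => next) n
  have hanti : Antitone fun n => (s n).1.1 := antitone_nat_of_succ_le fun n => hle (s n)
  have hmono : Monotone fun n => (s n).1.2 := monotone_nat_of_le_succ fun n => hsub (s n)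
  obtain ⟨p, hp⟩ := hX (fun n => (s n).1.1) (fun n => (s n).2.1) fun n => (s n).2.2.1
  have hfar : ∀ n, δ ≤ |f (p, z' (s n)) - f (p, w' (s n))| := fun n =>
    closure_minimal (iUnion₂_subset fun m (hm : m ≥ n + 1) x hx =>
        (hlt (s n) x (hanti hm hx)).le)
      (isClosed_le continuous_const (hosc _ _)) (hp (n + 1))
  -- A coordinate is either absorbed at some stage, or lies outside every support, where both points
  -- vanish.
  have hclose : ∀ t, ∀ᶠ n in atTop, e (z' (s n)) t = e (w' (s n)) t := by
    intro t
    by_cases ht : ∃ m, t ∈ (s m).1.2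
    · obtain ⟨m, hm⟩ := ht
      filter_upwards [eventually_ge_atTop m] with n hn
      exact hzw' (s n) (hmono hn hm)
    · push Not at ht
      refine Eventually.of_forall fun n => ?_
      rw [Function.notMem_support.1 fun h => ht (n + 1) (hz' (s n) h),
        Function.notMem_support.1 fun h => ht (n + 1) (hw' (s n) h)]
  obtain ⟨⟨a, b⟩, -, hab⟩ := isCompact_univ.exists_mapClusterPt (f := atTop)
    (u := fun n => (z' (s n), w' (s n))) (by simp)
  have hmem : ∀ K : Set (Y × Y), IsClosed K → (∀ᶠ n in atTop, (z' (s n), w' (s n)) ∈ K) →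
      (a, b) ∈ K := fun K hK h => by
    rw [← hK.closure_eq]
    exact hab.clusterPt.mem_closure_of_mem _ h
  have hec : ∀ t, Continuous fun y => e y t := fun t => (continuous_apply t).comp he.continuous
  have hfc := hf.1 p
  have heq : a = b := he.injective <| funext fun t =>
    hmem {q | e q.1 t = e q.2 t}
      (isClosed_eq ((hec t).comp continuous_fst) ((hec t).comp continuous_snd)) (hclose t)
  have hge : δ ≤ |f (p, a) - f (p, b)| :=
    hmem {q | δ ≤ |f (p, q.1) - f (p, q.2)|}
      (isClosed_le continuous_const ((hfc.comp continuous_fst).sub (hfc.comp continuous_snd)).abs)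
      (Eventually.of_forall hfar)
  rw [heq, sub_self, abs_zero] at hge
  exact hδ.not_ge hge

/-- Cutting a countably supported point off to `A` leaves `f (x, ·)` unchanged, and the cut-off
comes from a point of `closure C`. -/
theorem exists_countable_determining (hX : IsFeeblyCompact X) (hS : HasCountableSuslinNumber X)
    (he : IsEmbedding e) (hd : Dense {y | (Function.support (e y)).Countable}) {f : X × Y → ℝ}
    (hf : SeparatelyContinuous f) :
    ∃ C : Set Y, C.Countable ∧ ∀ x, (∀ c ∈ C, f (x, c) = 0) → ∀ y, f (x, y) = 0 := by
  choose D hD hDf using fun n : ℕ => exists_countable_oscillation_le hX hS he hf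
    (show (0 : ℝ) < 1 / (n + 1) by positivity)
  obtain ⟨A, hDA, hA, C, hC, hCA⟩ :=
    exists_countable_indicator_mem_closure he.continuous hd (countable_iUnion hD)
  refine ⟨C, hC, fun x hx => ?_⟩
  have hcl : closure C ⊆ {y | f (x, y) = 0} :=
    closure_minimal hx (isClosed_eq (hf.1 x) continuous_const)
  suffices h : {y | (Function.support (e y)).Countable} ⊆ {y | f (x, y) = 0} from fun y =>
    closure_minimal h (isClosed_eq (hf.1 x) continuous_const) (hd y)
  intro z hz
  obtain ⟨w, hw, hwz⟩ : A.indicator (e z) ∈ e '' closure C :=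
    closure_minimal (image_mono subset_closure)
      (isClosed_closure.isCompact.image he.continuous).isClosed (hCA z)
  have hw0 : f (x, w) = 0 := hcl hw
  have hzw : f (x, z) - f (x, w) = 0 := by
    refine abs_nonpos_iff.1 (le_of_forall_pos_le_add fun δ hδ => ?_)
    obtain ⟨n, hn⟩ := exists_nat_one_div_lt hδ
    rw [zero_add]
    refine (hDf n x z w hz ?_ fun t ht => ?_).trans hn.le
    · rw [hwz]
      exact hA.mono support_indicator_subset
    · rw [hwz, indicator_of_mem (hDA (mem_iUnion.2 ⟨n, ht⟩))]
  rwa [hw0, sub_zero] at hzw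

end CountableSupport

/-! ### Assembling the equivalence -/

theorem IsValdiviaCompact.exists_isEmbedding.{u} {Y : Type u} [TopologicalSpace Y]
    (hY : IsValdiviaCompact Y) : CompactSpace Y ∧ T2Space Y ∧ ∃ (T : Type u) (e : Y → T → ℝ),
      IsEmbedding e ∧ Dense {y | (Function.support (e y)).Countable} := by
  obtain ⟨T, Z, hZ, ⟨φ⟩, hd⟩ := hY
  have := isCompact_iff_compactSpace.1 hZ
  refine ⟨φ.symm.compactSpace, φ.symm.t2Space, T, fun y => φ y,
    IsEmbedding.subtypeVal.comp φ.isEmbedding, ?_⟩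
  exact hd.preimage φ.isOpenMap

theorem exists_setsConvergeTo_of_countable_determining {X Y : Type*} [TopologicalSpace X]
    [TopologicalSpace Y] [RegularSpace X] [RegularSpace Y] [CompactSpace Y]
    (hX : IsFeeblyCompact X) {f : X × Y → ℝ} (hf : SeparatelyContinuous f) {x₀ : X} {y₀ : Y}
    (hD : discontinuitySet f = {(x₀, y₀)})
    (hdet : ∀ g : X × Y → ℝ, SeparatelyContinuous g →
      (∃ C : Set X, C.Countable ∧ ∀ y, (∀ c ∈ C, g (c, y) = 0) → ∀ x, g (x, y) = 0) ∨
      ∃ C : Set Y, C.Countable ∧ ∀ x, (∀ c ∈ C, g (x, c) = 0) → ∀ y, g (x, y) = 0) :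
    (∃ U : ℕ → Set X, (∀ n, IsOpen (U n)) ∧ SetsConvergeTo U x₀) ∧
      (∃ V : ℕ → Set Y, (∀ n, IsOpen (V n)) ∧ SetsConvergeTo V y₀) := by
  have h1 := hf.1 x₀
  have h2 := hf.2 y₀
  let k : X × Y → ℝ := fun p => f (x₀, p.2) + f (p.1, y₀) - f (x₀, y₀)
  have hk : Continuous k := ((h1.comp continuous_snd).add (h2.comp continuous_fst)).sub
    continuous_const
  let g : X × Y → ℝ := fun p => f p - k p
  have hg : SeparatelyContinuous g :=
    ⟨fun x => (hf.1 x).sub (hk.comp (by fun_prop : Continuous fun y => (x, y))),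
      fun y => (hf.2 y).sub (hk.comp (by fun_prop : Continuous fun x => (x, y)))⟩
  have hgx : ∀ y, g (x₀, y) = 0 := fun y => by simp only [g, k]; ring
  have hgy : ∀ x, g (x, y₀) = 0 := fun x => by simp only [g, k]; ring
  have hDg : discontinuitySet g = {(x₀, y₀)} := by
    rw [← hD]
    ext p
    refine not_congr ⟨fun h => ?_, fun h => h.sub hk.continuousAt⟩
    simpa [g, Pi.add_def] using h.add hk.continuousAt
  obtain ⟨C, hC, hCg⟩ | ⟨C, hC, hCg⟩ := hdet g hg
  -- Adding `x₀`, whose section is zero, makes the set nonempty and hence enumerable by `ℕ`.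
  · obtain ⟨c, hc⟩ := (hC.insert x₀).exists_eq_range (insert_nonempty _ _)
    refine exists_setsConvergeTo_of_discontinuitySet_eq_singleton hX hDg (hgx y₀)
      (g := fun i p => g (c i, p.2)) (fun i => (hg.1 (c i)).comp continuous_snd)
      (fun i => hgy _) fun p hp => hCg p.2 (fun d hd => ?_) p.1
    obtain ⟨i, rfl⟩ := hc.subset (mem_insert_of_mem _ hd)
    exact hp i
  · obtain ⟨c, hc⟩ := (hC.insert y₀).exists_eq_range (insert_nonempty _ _)
    refine exists_setsConvergeTo_of_discontinuitySet_eq_singleton hX hDg (hgx y₀)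
      (g := fun i p => g (p.1, c i)) (fun i => (hg.2 (c i)).comp continuous_fst)
      (fun i => hgx _) fun p hp => hCg p.1 (fun d hd => ?_) p.2
    obtain ⟨i, rfl⟩ := hc.subset (mem_insert_of_mem _ hd)
    exact hp i

theorem theorem4p2 {X Y : Type*} [TopologicalSpace X] [TopologicalSpace Y]
    (h : (IsPseudocompactSpace X ∧ TopologicalSpace.SeparableSpace X ∧
            CompactSpace Y ∧ T2Space Y) ∨
          (IsPseudocompactSpace X ∧ HasCountableSuslinNumber X ∧ IsValdiviaCompact Y))
    (x₀ : X) (y₀ : Y) (hx₀ : ¬ IsOpen ({x₀} : Set X)) (hy₀ : ¬ IsOpen ({y₀} : Set Y)) :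
    (∃ f : X × Y → ℝ, SeparatelyContinuous f ∧ discontinuitySet f = {(x₀, y₀)}) ↔
      (∃ U : ℕ → Set X, (∀ n, IsOpen (U n)) ∧ SetsConvergeTo U x₀) ∧
      (∃ V : ℕ → Set Y, (∀ n, IsOpen (V n)) ∧ SetsConvergeTo V y₀) := by
  have hX : IsPseudocompactSpace X := h.elim And.left And.left
  have hY : CompactSpace Y ∧ T2Space Y := h.elim (fun h => h.2.2) fun h =>
    ⟨h.2.2.exists_isEmbedding.1, h.2.2.exists_isEmbedding.2.1⟩
  have := hX.t35
  have := hY.1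
  have := hY.2
  constructor
  · rintro ⟨f, hf, hD⟩
    refine exists_setsConvergeTo_of_countable_determining hX.isFeeblyCompact hf hD fun g hg => ?_
    obtain ⟨-, hsep, -⟩ | ⟨-, hS, hV⟩ := h
    · obtain ⟨C, hC, hCd⟩ := TopologicalSpace.exists_countable_dense X
      exact Or.inl ⟨C, hC, fun y hy x =>
        closure_minimal hy (isClosed_eq (hg.2 y) continuous_const) (hCd x)⟩
    · obtain ⟨-, -, T, e, he, hd⟩ := hV.exists_isEmbedding
      exact Or.inr (exists_countable_determining hX.isFeeblyCompact hS he hd hg)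
  · rintro ⟨⟨U, hUo, hU⟩, V, hVo, hV⟩
    exact exists_separatelyContinuous_of_setsConvergeTo hx₀ hy₀ hUo hU hVo hV
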